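/- Let $N$ be a non-negative integer, let $K$ be a field, and let $X=(x_1,\dots,x_{N-1})$ and $Y=(y_1,\dots,y_{N-2})$ be arbitrary sequences of elements of $K$. The Okada algebra $O_N(X,Y)$ is the unital associative $K$-algebra generated by $E_1,\dots,E_{N-1}$ with the relations \begin{align*} E_i^2 &= x_i E_i && (1\le i\le N-1),\\ E_iE_j &= E_jE_i && (|i-j|\ge 2),\\ E_{i+1}E_iE_{i+1} &= y_i E_{i+1} && (1\le i\le N-2). \end{align*} The Okada monoid $O_N$ is the monoid generated by $E_1,\dots,E_{N-1}$ with the same relations in which all $x_i$ and $y_i$ are equal to $1$. For a permutation $\sigma$ in the symmetric group $S_N$, let $c_i=\#\{j<i : \sigma^{-1}(j)>\sigma^{-1}(i)\}$ for $1\le i\le N$ (the code of $\sigma$), and let $$e_\sigma=\prod_{i=1}^{N} E_{i-1}E_{i-2}\cdots E_{i-c_i},$$ where the factors are multiplied from left to right with $i$ increasing, and the $i$-th factor is $1$ if $c_i=0$; this defines an element $e_\sigma$ both of $O_N$ and of $O_N(X,Y)$. **Theorem.** The map $\sigma\mapsto e_\sigma$ is a bijection from $S_N$ onto the Okada monoid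 $O_N$, and the family $(e_\sigma)_{\sigma\in S_N}$ is a $K$-basis of the Okada algebra $O_N(X,Y)$. In particular $\dim_K O_N(X,Y)=N!$, for every choice of the parameters $X$ and $Y$. -/

import Mathlib

namespace Okada

/-- The defining relations of the Okada algebra `O_N(X, Y)`. The generator `E_i` (`1 ≤ i ≤ N - 1`)
is the letter `i - 1 : Fin (N - 1)`, and the parameters `x_i` and `y_i` are `X (i - 1)` and
`Y (i - 1)`. -/
inductive AlgRel {K : Type*} [Field K] (N : ℕ) (X : Fin (N - 1) → K) (Y : Fin (N - 2) → K) :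
    FreeAlgebra K (Fin (N - 1)) → FreeAlgebra K (Fin (N - 1)) → Prop
  /-- `E_i ^ 2 = x_i E_i` -/
  | sq (i : Fin (N - 1)) :
      AlgRel N X Y (FreeAlgebra.ι K i * FreeAlgebra.ι K i) (X i • FreeAlgebra.ι K i)
  /-- `E_i E_j = E_j E_i` for `|i - j| ≥ 2` -/
  | comm (i j : Fin (N - 1)) (h : (i : ℕ) + 2 ≤ j ∨ (j : ℕ) + 2 ≤ i) :
      AlgRel N X Y (FreeAlgebra.ι K i * FreeAlgebra.ι K j)
        (FreeAlgebra.ι K j * FreeAlgebra.ι K i)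
  /-- `E_{i+1} E_i E_{i+1} = y_i E_{i+1}` for `1 ≤ i ≤ N - 2` -/
  | sandwich (i : Fin (N - 2)) :
      AlgRel N X Y
        (FreeAlgebra.ι K ⟨i + 1, by omega⟩ * FreeAlgebra.ι K ⟨i, by omega⟩ *
          FreeAlgebra.ι K ⟨i + 1, by omega⟩)
        (Y i • FreeAlgebra.ι K ⟨i + 1, by omega⟩)

/-- The Okada algebra `O_N(X, Y)`. -/
abbrev Alg {K : Type*} [Field K] (N : ℕ) (X : Fin (N - 1) → K) (Y : Fin (N - 2) → K) :
    Type _ :=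
  RingQuot (AlgRel N X Y)

/-- The generators of the Okada algebra. -/
noncomputable def Alg.gen {K : Type*} [Field K] {N : ℕ} (X : Fin (N - 1) → K)
    (Y : Fin (N - 2) → K) (i : Fin (N - 1)) : Alg N X Y :=
  RingQuot.mkAlgHom K (AlgRel N X Y) (FreeAlgebra.ι K i)

/-- The defining relations of the Okada monoid: the same, with all parameters equal to `1`. -/
inductive MonRel (N : ℕ) : FreeMonoid (Fin (N - 1)) → FreeMonoid (Fin (N - 1)) → Prop
  | sq (i : Fin (N - 1)) :
      MonRel N (FreeMonoid.of i * FreeMonoid.of i) (FreeMonoid.of i)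
  | comm (i j : Fin (N - 1)) (h : (i : ℕ) + 2 ≤ j ∨ (j : ℕ) + 2 ≤ i) :
      MonRel N (FreeMonoid.of i * FreeMonoid.of j) (FreeMonoid.of j * FreeMonoid.of i)
  | sandwich (i : Fin (N - 2)) :
      MonRel N
        (FreeMonoid.of ⟨i + 1, by omega⟩ * FreeMonoid.of ⟨i, by omega⟩ *
          FreeMonoid.of ⟨i + 1, by omega⟩)
        (FreeMonoid.of ⟨i + 1, by omega⟩)

/-- The Okada monoid. -/
abbrev Mon (N : ℕ) : Type := PresentedMonoid (MonRel N)

/-- The generators of the Okada monoid. -/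
def Mon.gen {N : ℕ} (i : Fin (N - 1)) : Mon N := PresentedMonoid.of (MonRel N) i

/-- The code of a permutation: `c_i` is the number of `j < i` with `σ⁻¹ j > σ⁻¹ i`. -/
def code {N : ℕ} (σ : Equiv.Perm (Fin N)) (i : Fin N) : ℕ :=
  (Finset.univ.filter fun j : Fin N => j < i ∧ σ⁻¹ i < σ⁻¹ j).card

theorem code_le {N : ℕ} (σ : Equiv.Perm (Fin N)) (i : Fin N) : code σ i ≤ i := by
  calc code σ i ≤ (Finset.Iio i).card :=
        Finset.card_le_card fun j hj => by
          simp only [Finset.mem_filter] at hj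
          exact Finset.mem_Iio.2 hj.2.1
    _ = i := Fin.card_Iio i

/-- The descending run of `code σ i` letters `i - 1, i - 2, …, i - code σ i`. Since both `Fin N`
and the letters in `Fin (N - 1)` are counted from `0`, these are the generators
`E_{I-1}, E_{I-2}, …, E_{I-c_I}` for `I = i + 1`. -/
def run {N : ℕ} (σ : Equiv.Perm (Fin N)) (i : Fin N) : List (Fin (N - 1)) :=
  List.ofFn fun k : Fin (code σ i) =>
    ⟨(i : ℕ) - 1 - k, by have h₁ := code_le σ i; have h₂ := k.2; have h₃ := i.2; omega⟩

/-- The word of `σ`: the concatenation of its descending runs, for increasing `i`. -/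
def word {N : ℕ} (σ : Equiv.Perm (Fin N)) : List (Fin (N - 1)) :=
  (List.ofFn fun i : Fin N => run σ i).flatten

/-- The monomial `e_σ` in the Okada monoid. -/
def Mon.e {N : ℕ} (σ : Equiv.Perm (Fin N)) : Mon N :=
  ((word σ).map Mon.gen).prod

/-- The monomial `e_σ` in the Okada algebra. -/
noncomputable def Alg.e {K : Type*} [Field K] {N : ℕ} (X : Fin (N - 1) → K)
    (Y : Fin (N - 2) → K) (σ : Equiv.Perm (Fin N)) : Alg N X Y :=
  ((word σ).map (Alg.gen X Y)).prod

end Okada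

namespace Okada

/-! Let `g 0, …, g (n - 1)` satisfy the relations of rank n + 1, and let D_k = g_{n-1} ⋯ g_k for 0 ≤
k ≤ n, so that D_n = 1. Everything rests on one rule (`IsOkada.dsc_mul`): D_k g_i = a D_l, where a
is an expression in the rank-n generators and the parameters.

Spanning: a code monomial of rank n + 1 is one of rank n times some D_k. By the rule and induction,
the span of these monomials is stable under right multiplication by the generators. It contains 1,
so it is everything (`IsOkada.codeSpan_eq_top`).

Independence needs a large enough model. Read as definitions, the same formulas give (n + 1) × (n +
1) matrices over a model of rank n, and these satisfy the relations of rank n + 1 for all parameters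
(`IsOkada.genMatrix`). The last row of the matrix of a code monomial is its rank-n part placed in
column k, so independence passes from n to n + 1 (`linearIndependent_codeProd_genMatrix`).

Permutations correspond bijectively to codes (`permCode_bijective`). For the monoid, injectivity
comes from mapping to the algebra over ℚ with all parameters 1, and surjectivity from spanning in
the monoid algebra. -/

variable {K A : Type*} [Field K] [Ring A] [Algebra K A]

/-- The elements `g 0, …, g (n - 2)` of `A` satisfy the relations of the Okada algebra of
rank `n`. -/
structure IsOkada (n : ℕ) (x y : ℕ → K) (g : ℕ → A) : Prop where
  sq : ∀ i, i + 1 < n → g i * g i = x i • g i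
  comm : ∀ i j, i + 2 ≤ j → j + 1 < n → g i * g j = g j * g i
  sandwich : ∀ i, i + 2 < n → g (i + 1) * g i * g (i + 1) = y i • g (i + 1)

theorem IsOkada.mono {n m : ℕ} {x y : ℕ → K} {g : ℕ → A} (h : IsOkada n x y g) (hm : m ≤ n) :
    IsOkada m x y g :=
  ⟨fun i hi => h.sq i (by omega), fun i j hij hj => h.comm i j hij (by omega),
    fun i hi => h.sandwich i (by omega)⟩

/-! ### Descending products and the straightening rule -/

/-- The descending product `g (b - 1) * g (b - 2) * ⋯ * g k`. -/
def dsc {A : Type*} [Monoid A] (g : ℕ → A) (b k : ℕ) : A :=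
  ((List.range (b - k)).map fun t => g (b - 1 - t)).prod

theorem dsc_of_le {A : Type*} [Monoid A] (g : ℕ → A) {b k : ℕ} (h : b ≤ k) : dsc g b k = 1 := by
  simp [dsc, Nat.sub_eq_zero_of_le h]

theorem dsc_eq_mul_right {A : Type*} [Monoid A] (g : ℕ → A) {b k : ℕ} (h : k < b) :
    dsc g b k = dsc g b (k + 1) * g k := by
  have h1 : b - k = (b - (k + 1)) + 1 := by omega
  rw [dsc, h1, List.range_succ, List.map_append, List.prod_append, dsc]
  simp only [List.map_cons, List.map_nil, List.prod_singleton]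
  congr 2
  omega

theorem dsc_eq_mul_left {A : Type*} [Monoid A] (g : ℕ → A) {b k : ℕ} (h : k ≤ b) :
    dsc g (b + 1) k = g b * dsc g b k := by
  have h1 : b + 1 - k = (b - k) + 1 := by omega
  rw [dsc, h1, List.range_succ_eq_map, List.map_cons, List.prod_cons, dsc, List.map_map]
  congr 3
  funext t
  simp only [Function.comp]
  congr 1
  omega

section relations

variable {n : ℕ} {x y : ℕ → K} {g : ℕ → A}

theorem IsOkada.commute_dsc_of_lt (h : IsOkada n x y g) {b k i : ℕ} (hb : b < i)
    (hi : i + 1 < n) : Commute (dsc g b k) (g i) := by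
  induction b with
  | zero => simp [dsc_of_le]
  | succ b ih =>
    rcases Nat.lt_or_ge b k with hk | hk
    · simp [dsc_of_le g hk]
    · rw [dsc_eq_mul_left g hk]
      exact Commute.mul_left (h.comm b i (by omega) hi) (ih (by omega))

theorem IsOkada.commute_dsc_of_add_two_le (h : IsOkada n x y g) {b k i : ℕ} (hk : i + 2 ≤ k)
    (hb : b < n) : Commute (dsc g b k) (g i) := by
  induction b with
  | zero => simp [dsc_of_le]
  | succ b ih =>
    rcases Nat.lt_or_ge b k with hk | hk
    · simp [dsc_of_le g hk]
    · rw [dsc_eq_mul_left g hk]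
      exact Commute.mul_left (h.comm i b (by omega) hb).symm (ih (by omega))

/-- The new letter moves left past g_{i-1} ⋯ g_k until it meets g_{i+1} g_i. The sandwich relation
then removes g_i, and the two remaining runs commute. -/
theorem IsOkada.dsc_mul_of_mem (h : IsOkada n x y g) {b k i : ℕ} (hk : k ≤ i) (hi : i + 1 < b)
    (hb : b < n) : dsc g b k * g (i + 1) = y i • (dsc g i k * dsc g b (i + 1)) := by
  induction b, hi using Nat.le_induction with
  | base =>
    rw [dsc_eq_mul_left g (by omega), dsc_eq_mul_left g hk, mul_assoc, mul_assoc,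
      (h.commute_dsc_of_lt (Nat.lt_succ_self i) (by omega)).eq, ← mul_assoc, ← mul_assoc,
      h.sandwich i (by omega), dsc_eq_mul_left g le_rfl, dsc_of_le g le_rfl, mul_one,
      smul_mul_assoc, (h.commute_dsc_of_lt (Nat.lt_succ_self i) (by omega)).eq]
  | succ b hb' ih =>
    have hb'' : i + 2 ≤ b := hb'
    rw [dsc_eq_mul_left g (by omega), mul_assoc, ih (by omega), mul_smul_comm, ← mul_assoc,
      ← (h.commute_dsc_of_lt (by omega) hb).eq, mul_assoc, ← dsc_eq_mul_left g (by omega)]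

end relations

/-- The index of the descending product in the expansion of `dsc g n k * g i`. -/
def target (i k : ℕ) : ℕ := if i + 2 ≤ k then k else i

/-- The left coefficient in the expansion of `dsc g n k * g i`. -/
def coeff (x y : ℕ → K) (g : ℕ → A) (i k : ℕ) : A :=
  if i + 2 ≤ k then g i
  else if i + 1 = k then 1
  else if i = k then algebraMap K A (x i)
  else y (i - 1) • dsc g (i - 1) k

theorem target_le {n i k : ℕ} (hi : i ≤ n) (hk : k ≤ n) : target i k ≤ n := by
  unfold target; split_ifs <;> assumption

section coeff

variable {n : ℕ} {x y : ℕ → K} {g : ℕ → A} {i j k : ℕ}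

theorem coeff_of_add_two_le (h : i + 2 ≤ k) : coeff x y g i k = g i := if_pos h

theorem coeff_add_one : coeff x y g i (i + 1) = 1 := by simp [coeff]

theorem coeff_self : coeff x y g i i = algebraMap K A (x i) := by simp [coeff]

theorem coeff_of_le (h : k ≤ i) : coeff x y g (i + 1) k = y i • dsc g i k := by
  rw [coeff, if_neg (by omega), if_neg (by omega), if_neg (by omega), Nat.add_sub_cancel]

theorem target_of_add_two_le (h : i + 2 ≤ k) : target i k = k := if_pos h

theorem target_of_le (h : k ≤ i + 1) : target i k = i := if_neg (by omega)

theorem coeff_cases (i k : ℕ) :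
    i + 2 ≤ k ∨ k = i + 1 ∨ k = i ∨ ∃ p, i = p + 1 ∧ k ≤ p := by
  rcases Nat.lt_or_ge k i with h | h
  · exact Or.inr (Or.inr (Or.inr ⟨i - 1, by omega, by omega⟩))
  · omega

/-- The four cases: g_i commutes past the run, lengthens it, squares its last letter, or is absorbed
by a sandwich. -/
theorem IsOkada.dsc_mul (h : IsOkada (n + 1) x y g) (hk : k ≤ n) (hi : i < n) :
    dsc g n k * g i = coeff x y g i k * dsc g n (target i k) := by
  rcases coeff_cases i k with h' | rfl | rfl | ⟨p, rfl, h'⟩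
  · rw [coeff_of_add_two_le h', target_of_add_two_le h',
      (h.commute_dsc_of_add_two_le h' (by omega)).eq]
  · rw [coeff_add_one, target_of_le le_rfl, one_mul, ← dsc_eq_mul_right g hi]
  · rw [coeff_self, target_of_le (by omega), dsc_eq_mul_right g hi, mul_assoc,
      h.sq _ (by omega), mul_smul_comm, Algebra.smul_def]
  · rw [coeff_of_le h', target_of_le (by omega), h.dsc_mul_of_mem h' hi (by omega),
      smul_mul_assoc]

/-- This lemma and the next two are the matrix relations read off in row k. Only the relations of
rank n may be used, since those of rank n + 1 are what the matrices are meant to realise. -/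
theorem IsOkada.coeff_sq (h : IsOkada n x y g) (hk : k ≤ n) :
    coeff x y g i k * coeff x y g i (target i k) = x i • coeff x y g i k := by
  rcases Nat.lt_or_ge k (i + 2) with h' | h'
  · rw [target_of_le (by omega), coeff_self, ← Algebra.commutes, Algebra.smul_def]
  · rw [target_of_add_two_le h', coeff_of_add_two_le h', h.sq i (by omega)]

theorem IsOkada.coeff_sandwich (h : IsOkada n x y g) (hk : k ≤ n) :
    coeff x y g (i + 1) k * coeff x y g i (target (i + 1) k) *
      coeff x y g (i + 1) (target i (target (i + 1) k)) = y i • coeff x y g (i + 1) k := by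
  rcases Nat.lt_or_ge k (i + 3) with h' | h'
  · rw [target_of_le (i := i + 1) (by omega), target_of_le le_rfl, coeff_add_one,
      coeff_of_le le_rfl, dsc_of_le g le_rfl, mul_one, mul_smul_comm, mul_one]
  · rw [target_of_add_two_le h', target_of_add_two_le (i := i) (by omega),
      coeff_of_add_two_le h', coeff_of_add_two_le (by omega), h.sandwich i (by omega)]

theorem IsOkada.coeff_comm (h : IsOkada n x y g) (hk : k ≤ n) (hij : i + 2 ≤ j) (hj : j < n) :
    coeff x y g i k * coeff x y g j (target i k) =
      coeff x y g j k * coeff x y g i (target j k) := by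
  rcases coeff_cases j k with h' | rfl | rfl | ⟨q, rfl, h'⟩
  · rw [target_of_add_two_le h', target_of_add_two_le (by omega), coeff_of_add_two_le h',
      coeff_of_add_two_le (by omega), h.comm i j hij (by omega)]
  · rw [target_of_le le_rfl, target_of_add_two_le (by omega), coeff_add_one,
      coeff_of_add_two_le (by omega), coeff_of_add_two_le hij, one_mul, mul_one]
  · rw [target_of_le (i := k) (by omega), target_of_add_two_le hij, coeff_self,
      coeff_of_add_two_le hij, Algebra.commutes]
  · rw [target_of_le (i := q + 1) (by omega), coeff_of_le h', coeff_of_add_two_le hij]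
    rcases coeff_cases i k with h'' | rfl | rfl | ⟨p, rfl, h''⟩
    · rw [target_of_add_two_le h'', coeff_of_add_two_le h'', coeff_of_le h', mul_smul_comm,
        smul_mul_assoc, (h.commute_dsc_of_add_two_le h'' (by omega)).eq]
    · rw [target_of_le le_rfl, coeff_add_one, coeff_of_le (by omega), one_mul, smul_mul_assoc,
        ← dsc_eq_mul_right g (by omega)]
    · rw [target_of_le (by omega), coeff_self, coeff_of_le h', mul_smul_comm, smul_mul_assoc,
        dsc_eq_mul_right g (by omega), mul_assoc, h.sq _ (by omega), mul_smul_comm,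
        Algebra.smul_def (x k)]
    · rw [target_of_le (by omega), coeff_of_le h'', coeff_of_le (by omega), smul_mul_assoc,
        smul_mul_assoc, mul_smul_comm, h.dsc_mul_of_mem h'' (by omega) (by omega), smul_comm]

end coeff

/-! ### The matrix model of rank n + 1 over a model of rank n -/

/-- The matrix whose `k`-th row has the single nonzero entry `a k`, in the column `t k`. -/
def rowMatrix (n : ℕ) (a : ℕ → A) (t : ℕ → ℕ) : Matrix (Fin (n + 1)) (Fin (n + 1)) A :=
  Matrix.of fun k l => if (l : ℕ) = t k then a k else 0

theorem rowMatrix_apply (n : ℕ) (a : ℕ → A) (t : ℕ → ℕ) (k l : Fin (n + 1)) :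
    rowMatrix n a t k l = if (l : ℕ) = t k then a k else 0 := rfl

theorem rowMatrix_mul {n : ℕ} (a b : ℕ → A) {s t : ℕ → ℕ} (hs : ∀ k ≤ n, s k ≤ n) :
    rowMatrix n a s * rowMatrix n b t = rowMatrix n (fun k => a k * b (s k)) (t ∘ s) := by
  ext k l
  have hk : s k < n + 1 := Nat.lt_succ_of_le (hs k (Nat.le_of_lt_succ k.2))
  rw [Matrix.mul_apply, Finset.sum_eq_single ⟨s k, hk⟩]
  · simp [rowMatrix_apply]
  · intro m _ hm
    have : (m : ℕ) ≠ s k := fun h => hm (Fin.ext h)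
    simp [rowMatrix_apply, this]
  · simp

theorem smul_rowMatrix (n : ℕ) (c : K) (a : ℕ → A) (t : ℕ → ℕ) :
    c • rowMatrix n a t = rowMatrix n (fun k => c • a k) t := by
  ext k l
  simp [rowMatrix_apply]

theorem rowMatrix_congr {n : ℕ} {a b : ℕ → A} {s t : ℕ → ℕ} (h : ∀ k ≤ n, a k = b k)
    (h' : ∀ k ≤ n, s k = t k) : rowMatrix n a s = rowMatrix n b t := by
  ext k l
  have hk := Nat.le_of_lt_succ k.2
  rw [rowMatrix_apply, rowMatrix_apply, h k hk, h' k hk]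

/-- The matrix of right multiplication by the `i`-th generator of rank `n + 1` on the
descending products `dsc g n 0, …, dsc g n n`, with coefficients in rank `n`. -/
def genMatrix (n : ℕ) (x y : ℕ → K) (g : ℕ → A) (i : ℕ) :
    Matrix (Fin (n + 1)) (Fin (n + 1)) A :=
  rowMatrix n (coeff x y g i) (target i)

theorem IsOkada.genMatrix {n : ℕ} {x y : ℕ → K} {g : ℕ → A} (h : IsOkada n x y g) :
    IsOkada (n + 1) x y (genMatrix n x y g) where
  sq i hi := by
    rw [Okada.genMatrix, rowMatrix_mul _ _ fun k => target_le (by omega), smul_rowMatrix]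
    refine rowMatrix_congr (fun k hk => h.coeff_sq hk) fun k hk => ?_
    simp only [target, Function.comp]; split_ifs <;> omega
  comm i j hij hj := by
    rw [Okada.genMatrix, Okada.genMatrix, rowMatrix_mul _ _ fun k => target_le (by omega),
      rowMatrix_mul _ _ fun k => target_le (by omega)]
    refine rowMatrix_congr (fun k hk => h.coeff_comm hk hij (by omega)) fun k hk => ?_
    simp only [target, Function.comp]; split_ifs <;> omega
  sandwich i hi := by
    rw [Okada.genMatrix, Okada.genMatrix, rowMatrix_mul _ _ fun k => target_le (by omega),
      rowMatrix_mul, smul_rowMatrix]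
    swap; · exact fun k hk => target_le (by omega) (target_le (by omega) hk)
    refine rowMatrix_congr (fun k hk => h.coeff_sandwich hk) fun k hk => ?_
    simp only [target, Function.comp]; split_ifs <;> omega

/-! ### Code monomials and their linear independence -/

/-- Codes of length `n`: sequences with `0 ≤ c i ≤ i`. -/
abbrev Code (n : ℕ) : Type := ∀ i : Fin n, Fin (i + 1)

/-- The monomial with a given code. -/
def codeProd {A : Type*} [Monoid A] (g : ℕ → A) {n : ℕ} (c : Code n) : A :=
  (List.ofFn fun i => dsc g i (i - c i)).prod

/-- The restriction of a code to its first `n` entries. -/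
def Code.init {n : ℕ} (c : Code (n + 1)) : Code n := fun i => c i.castSucc

theorem codeProd_succ {A : Type*} [Monoid A] (g : ℕ → A) {n : ℕ} (c : Code (n + 1)) :
    codeProd g c = codeProd g c.init * dsc g n (n - c (Fin.last n)) := by
  rw [codeProd, List.ofFn_succ', List.concat_eq_append, List.prod_append, List.prod_singleton]
  rfl

/-- A code is determined by its initial part and the complement of its last entry. -/
def Code.split {n : ℕ} (c : Code (n + 1)) : (_ : Fin (n + 1)) × Code n :=
  ⟨⟨n - c (Fin.last n), by omega⟩, c.init⟩

theorem Code.split_injective {n : ℕ} : Function.Injective (Code.split (n := n)) := by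
  intro c d h
  simp only [Code.split, Sigma.mk.injEq, Fin.mk.injEq, heq_eq_eq] at h
  funext i
  refine Fin.lastCases ?_ (fun i => congrFun h.2 i) i
  have h1 := (c (Fin.last n)).2
  have h2 := (d (Fin.last n)).2
  have h3 : ((Fin.last n : Fin (n + 1)) : ℕ) = n := rfl
  exact Fin.ext (by omega)

/-- The last row stands for the empty run D_n = 1, past which the generators of rank n move
unchanged. -/
theorem genMatrix_last {n : ℕ} (x y : ℕ → K) (g : ℕ → A) {i : ℕ} (hi : i + 2 ≤ n) :
    (genMatrix n x y g i).row (Fin.last n) = Pi.single (Fin.last n) (g i) := by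
  ext l
  simp [genMatrix, rowMatrix_apply, Pi.single_apply, target_of_add_two_le hi,
    coeff_of_add_two_le hi, Fin.ext_iff]

section rows

variable {n : ℕ} {M M' : Matrix (Fin (n + 1)) (Fin (n + 1)) A} {j k l : Fin (n + 1)} {a b : A}

theorem row_mul_single (hM : M.row j = Pi.single k a) (hM' : M'.row k = Pi.single l b) :
    (M * M').row j = Pi.single l (a * b) := by
  ext m
  have h1 : ∀ p, M j p = (Pi.single k a : Fin (n + 1) → A) p := congrFun hM
  have h2 : ∀ p, M' k p = (Pi.single l b : Fin (n + 1) → A) p := congrFun hM'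
  rw [Matrix.row_apply, Matrix.mul_apply, Finset.sum_eq_single k]
  · rw [h1, h2]
    by_cases h : m = l
    · subst h; simp
    · simp [h]
  · intro p _ hp
    simp [h1, hp]
  · simp

theorem row_one_single : (1 : Matrix (Fin (n + 1)) (Fin (n + 1)) A).row j = Pi.single j 1 := by
  ext m
  simp [Matrix.row_apply, Matrix.one_apply, Pi.single_apply, eq_comm]

end rows

theorem row_list_prod_last {n : ℕ} (L : List (Matrix (Fin (n + 1)) (Fin (n + 1)) A × A))
    (h : ∀ p ∈ L, p.1.row (Fin.last n) = Pi.single (Fin.last n) p.2) :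
    ((L.map Prod.fst).prod).row (Fin.last n) = Pi.single (Fin.last n) (L.map Prod.snd).prod := by
  induction L with
  | nil => simpa using row_one_single
  | cons p L ih =>
    simp only [List.map_cons, List.prod_cons]
    exact row_mul_single (h p (by simp)) (ih fun q hq => h q (by simp [hq]))

theorem dsc_genMatrix_row_of_lt {n : ℕ} (x y : ℕ → K) (g : ℕ → A) {b k : ℕ} (hb : b < n) :
    (dsc (genMatrix n x y g) b k).row (Fin.last n) = Pi.single (Fin.last n) (dsc g b k) := by
  have := row_list_prod_last
    ((List.range (b - k)).map fun t => (genMatrix n x y g (b - 1 - t), g (b - 1 - t))) (by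
      intro p hp
      obtain ⟨t, ht, rfl⟩ := List.mem_map.1 hp
      have := List.mem_range.1 ht
      exact genMatrix_last x y g (by omega))
  simpa only [List.map_map, Function.comp_def, dsc] using this

theorem codeProd_genMatrix_row {n : ℕ} (x y : ℕ → K) (g : ℕ → A) (c : Code n) :
    (codeProd (genMatrix n x y g) c).row (Fin.last n) =
      Pi.single (Fin.last n) (codeProd g c) := by
  have := row_list_prod_last
    (List.ofFn fun i : Fin n => (dsc (genMatrix n x y g) i (i - c i), dsc g i (i - c i))) (by
      intro p hp
      obtain ⟨i, rfl⟩ := (List.mem_ofFn' _ _).1 hp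
      exact dsc_genMatrix_row_of_lt x y g i.2)
  simpa only [List.map_ofFn, Function.comp_def, codeProd] using this

/-- Starting from the empty run, each successive letter lengthens the run by one, with coefficient
1. -/
theorem dsc_genMatrix_row {n : ℕ} (x y : ℕ → K) (g : ℕ → A) (k : Fin (n + 1)) :
    (dsc (genMatrix n x y g) n k).row (Fin.last n) = Pi.single k 1 := by
  induction k using Fin.reverseInduction with
  | last => rw [Fin.val_last, dsc_of_le _ le_rfl, row_one_single]
  | cast k ih =>
    rw [dsc_eq_mul_right _ (by simp), ← mul_one (1 : A)]
    refine row_mul_single ih ?_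
    ext l
    simp [genMatrix, rowMatrix_apply, Pi.single_apply, target_of_le, coeff_add_one, Fin.ext_iff]

theorem linearIndependent_codeProd_genMatrix {n : ℕ} (x y : ℕ → K) (g : ℕ → A)
    (h : LinearIndependent K fun c : Code n => codeProd g c) :
    LinearIndependent K fun c : Code (n + 1) => codeProd (genMatrix n x y g) c := by
  let row : Matrix (Fin (n + 1)) (Fin (n + 1)) A →ₗ[K] (Fin (n + 1) → A) :=
    LinearMap.proj (Fin.last n)
  refine LinearIndependent.of_comp row ?_
  -- Independent families placed in distinct columns remain independent together.
  have hsingle := (Pi.linearIndependent_single (fun _ : Fin (n + 1) => fun c : Code n => codeProd g c)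
    fun _ => h).comp _ Code.split_injective
  suffices hrow : (row ∘ fun c : Code (n + 1) => codeProd (genMatrix n x y g) c) =
      (fun p : (_ : Fin (n + 1)) × Code n => Pi.single p.1 (codeProd g p.2)) ∘ Code.split by
    rw [hrow]
    exact hsingle
  funext c
  have h1 := row_mul_single (codeProd_genMatrix_row x y g c.init)
    (dsc_genMatrix_row x y g c.split.1)
  rw [mul_one] at h1
  rw [Function.comp_apply, Function.comp_apply, codeProd_succ]
  exact h1

theorem exists_isOkada_linearIndependent.{u} {K : Type u} [Field K] (x y : ℕ → K) (n : ℕ) :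
    ∃ (A : Type u) (_ : Ring A) (_ : Algebra K A) (g : ℕ → A), IsOkada n x y g ∧
      LinearIndependent K fun c : Code n => codeProd g c := by
  induction n with
  | zero =>
    refine ⟨K, inferInstance, inferInstance, 0, ⟨by simp, by simp, by simp⟩, ?_⟩
    refine LinearIndependent.of_subsingleton default ?_
    simp [codeProd]
  | succ n ih =>
    obtain ⟨A, _, _, g, hg, hli⟩ := ih
    exact ⟨_, inferInstance, inferInstance, _, hg.genMatrix,
      linearIndependent_codeProd_genMatrix x y g hli⟩

/-! ### Code monomials span -/

/-- The span of the monomials with codes of length `n`. -/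
def codeSpan (K : Type*) {A : Type*} [Field K] [Ring A] [Algebra K A] (g : ℕ → A) (n : ℕ) :
    Submodule K A :=
  Submodule.span K (Set.range fun c : Code n => codeProd g c)

theorem mul_dsc_mem_codeSpan {g : ℕ → A} {n k : ℕ} {s : A} (hs : s ∈ codeSpan K g n)
    (hk : k ≤ n) : s * dsc g n k ∈ codeSpan K g (n + 1) := by
  induction hs using Submodule.span_induction with
  | mem s hs =>
    obtain ⟨c, rfl⟩ := hs
    refine Submodule.subset_span ⟨Fin.snoc (α := fun i : Fin (n + 1) => Fin (i + 1)) c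
      (⟨n - k, by simp⟩ : Fin ((Fin.last n : Fin (n + 1)) + 1)), ?_⟩
    dsimp only
    rw [codeProd_succ]
    congr 2
    · funext i
      exact Fin.snoc_castSucc (α := fun i : Fin (n + 1) => Fin (i + 1)) _ _ _
    · rw [Fin.snoc_last]
      simp only
      omega
  | zero => simp
  | add s t _ _ hs ht => rw [add_mul]; exact add_mem hs ht
  | smul a s _ hs => rw [smul_mul_assoc]; exact Submodule.smul_mem _ _ hs

theorem mul_list_prod_mem {S : Submodule K A} {L : List A} (hL : ∀ a ∈ L, ∀ s ∈ S, s * a ∈ S)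
    {s : A} (hs : s ∈ S) : s * L.prod ∈ S := by
  induction L generalizing s with
  | nil => simpa using hs
  | cons a L ih =>
    rw [List.prod_cons, ← mul_assoc]
    exact ih (fun b hb => hL b (by simp [hb])) (hL a (by simp) s hs)

theorem mul_coeff_mem {S : Submodule K A} {x y : ℕ → K} {g : ℕ → A} {n i k : ℕ}
    (hS : ∀ i, i + 1 < n → ∀ s ∈ S, s * g i ∈ S) (hi : i < n) (hk : k ≤ n) {s : A} (hs : s ∈ S) :
    s * coeff x y g i k ∈ S := by
  rcases coeff_cases i k with h' | rfl | rfl | ⟨p, rfl, h'⟩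
  · rw [coeff_of_add_two_le h']
    exact hS i (by omega) s hs
  · rwa [coeff_add_one, mul_one]
  · rw [coeff_self, ← Algebra.commutes, ← Algebra.smul_def]
    exact S.smul_mem _ hs
  · rw [coeff_of_le h', mul_smul_comm]
    refine S.smul_mem _ (mul_list_prod_mem (fun a ha => ?_) hs)
    obtain ⟨t, ht, rfl⟩ := List.mem_map.1 ha
    have := List.mem_range.1 ht
    exact hS _ (by omega)

/-- After straightening, the coefficient lies to the left of the run and is absorbed by the
induction hypothesis in rank n. -/
theorem IsOkada.mul_mem_codeSpan {n : ℕ} {x y : ℕ → K} {g : ℕ → A} (h : IsOkada n x y g) {i : ℕ}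
    (hi : i + 1 < n) {s : A} (hs : s ∈ codeSpan K g n) : s * g i ∈ codeSpan K g n := by
  induction n generalizing i s with
  | zero => omega
  | succ n ih =>
    induction hs using Submodule.span_induction with
    | mem s hs =>
      obtain ⟨c, rfl⟩ := hs
      dsimp only
      rw [codeProd_succ, mul_assoc, h.dsc_mul (by omega) (by omega), ← mul_assoc]
      refine mul_dsc_mem_codeSpan ?_ (target_le (by omega) (by omega))
      exact mul_coeff_mem (fun j hj s hs => ih (h.mono (by omega)) hj hs) (by omega) (by omega)
        (Submodule.subset_span ⟨c.init, rfl⟩)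
    | zero => simp
    | add s t _ _ hs ht => rw [add_mul]; exact add_mem hs ht
    | smul a s _ hs => rw [smul_mul_assoc]; exact Submodule.smul_mem _ _ hs

theorem one_mem_codeSpan (g : ℕ → A) (n : ℕ) : (1 : A) ∈ codeSpan K g n := by
  refine Submodule.subset_span ⟨fun _ => 0, List.prod_eq_one fun a ha => ?_⟩
  obtain ⟨i, rfl⟩ := (List.mem_ofFn' _ _).1 ha
  exact dsc_of_le g (by simp)

/-- If `g 0, …, g (n - 2)` generate `A` and satisfy the Okada relations, then the monomials
with codes of length `n` span `A`. -/
theorem IsOkada.codeSpan_eq_top {n : ℕ} {x y : ℕ → K} {g : ℕ → A} (h : IsOkada n x y g)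
    (hg : Algebra.adjoin K (g '' {i | i + 1 < n}) = ⊤) : codeSpan K g n = ⊤ := by
  rw [eq_top_iff]
  intro a _
  -- Quantifying over `s` makes the property of `a` pass to products.
  suffices ∀ s ∈ codeSpan K g n, s * a ∈ codeSpan K g n by
    simpa using this 1 (one_mem_codeSpan g n)
  have ha : a ∈ Algebra.adjoin K (g '' {i | i + 1 < n}) := hg ▸ Algebra.mem_top
  clear * - h ha
  induction ha using Algebra.adjoin_induction with
  | mem a ha =>
    obtain ⟨i, hi, rfl⟩ := ha
    exact fun s hs => h.mul_mem_codeSpan hi hs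
  | algebraMap r =>
    intro s hs
    rw [← Algebra.commutes, ← Algebra.smul_def]
    exact Submodule.smul_mem _ _ hs
  | add a b _ _ ha hb => exact fun s hs => by rw [mul_add]; exact add_mem (ha s hs) (hb s hs)
  | mul a b _ _ ha hb => exact fun s hs => by rw [← mul_assoc]; exact hb _ (ha s hs)

end Okada

/-! ### Permutations are determined by their codes -/

namespace Okada

/-- By induction σ⁻¹ and τ⁻¹ order the values below i alike. The sets counted by the two codes at i
are upper sets for this common total order, hence nested, and equal cardinality makes them equal. -/
theorem code_order_iff {N : ℕ} {σ τ : Equiv.Perm (Fin N)} (h : ∀ i, code σ i = code τ i)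
    (i : Fin N) : ∀ j < i, (σ⁻¹ i < σ⁻¹ j ↔ τ⁻¹ i < τ⁻¹ j) := by
  induction i using WellFoundedLT.induction with
  | ind i ih =>
    have hlt : ∀ j < i, ∀ k < i, (σ⁻¹ j < σ⁻¹ k ↔ τ⁻¹ j < τ⁻¹ k) := by
      intro j hj k hk
      rcases lt_trichotomy j k with hjk | rfl | hjk
      · have := ih k hk j hjk
        have h1 : σ⁻¹ j ≠ σ⁻¹ k := fun h => hjk.ne (σ⁻¹.injective h)
        have h2 : τ⁻¹ j ≠ τ⁻¹ k := fun h => hjk.ne (τ⁻¹.injective h)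
        rw [← not_iff_not, not_lt, not_lt, h1.symm.le_iff_lt, h2.symm.le_iff_lt]
        exact this
      · simp
      · exact ih j hj k hjk
    let S : Equiv.Perm (Fin N) → Finset (Fin N) := fun ρ =>
      Finset.univ.filter fun j => j < i ∧ ρ⁻¹ i < ρ⁻¹ j
    have hS : ∀ ρ j, j ∈ S ρ ↔ j < i ∧ ρ⁻¹ i < ρ⁻¹ j := by simp [S]
    suffices S σ = S τ by
      intro j hj
      have := congrArg (j ∈ ·) this
      simpa [hS, hj] using this
    have hcard : (S σ).card = (S τ).card := h i
    have hnested : S σ ⊆ S τ ∨ S τ ⊆ S σ := by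
      by_contra! hcon
      obtain ⟨h1, h2⟩ := hcon
      obtain ⟨a, ha, ha'⟩ := Finset.not_subset.1 h1
      obtain ⟨b, hb, hb'⟩ := Finset.not_subset.1 h2
      rw [hS] at ha ha' hb hb'
      have h3 : τ⁻¹ a < τ⁻¹ b := by
        by_contra hc
        exact ha' ⟨ha.1, hb.2.trans_le (not_lt.1 hc)⟩
      have h4 : σ⁻¹ b < σ⁻¹ a := by
        by_contra hc
        exact hb' ⟨hb.1, ha.2.trans_le (not_lt.1 hc)⟩
      exact lt_asymm h3 ((hlt b hb.1 a ha.1).1 h4)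
    rcases hnested with hs | hs
    · exact Finset.eq_of_subset_of_card_le hs hcard.ge
    · exact (Finset.eq_of_subset_of_card_le hs hcard.le).symm

theorem code_injective {N : ℕ} : Function.Injective (code (N := N)) := by
  intro σ τ h
  have h1 := code_order_iff (congrFun h)
  have hmono : StrictMono (τ⁻¹ * σ) := by
    intro a b hab
    have h2 : ∀ j k, σ⁻¹ j < σ⁻¹ k → τ⁻¹ j < τ⁻¹ k := by
      intro j k hjk
      rcases lt_trichotomy j k with hlt | rfl | hlt
      · by_contra hc
        rcases (not_lt.1 hc).lt_or_eq with hc | hc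
        · exact lt_asymm hjk ((h1 k j hlt).2 hc)
        · exact hlt.ne (τ⁻¹.injective hc.symm)
      · exact absurd hjk (lt_irrefl _)
      · exact (h1 j k hlt).1 hjk
    simpa using h2 (σ a) (σ b) (by simpa using hab)
  -- A finite chain has no order automorphism but the identity.
  have h3 : τ⁻¹ * σ = 1 := by
    ext a
    have := Subsingleton.elim (hmono.orderIsoOfSurjective _ (τ⁻¹ * σ).surjective)
      (OrderIso.refl (Fin N))
    exact congrArg Fin.val (congrArg (fun e : Fin N ≃o Fin N => e a) this)
  rw [inv_mul_eq_one] at h3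
  exact h3.symm

/-- The code of a permutation, as an element of `Code N`. -/
def permCode {N : ℕ} (σ : Equiv.Perm (Fin N)) : Code N :=
  fun i => ⟨code σ i, Nat.lt_succ_of_le (code_le σ i)⟩

theorem permCode_bijective {N : ℕ} : Function.Bijective (permCode (N := N)) := by
  rw [Fintype.bijective_iff_injective_and_card]
  refine ⟨fun σ τ h => code_injective (funext fun i => congrArg Fin.val (congrFun h i)), ?_⟩
  rw [Fintype.card_perm, Fintype.card_pi, Fintype.card_fin]
  simp only [Fintype.card_fin]
  rw [Fin.prod_univ_eq_prod_range (fun i => i + 1) N, Finset.prod_range_add_one_eq_factorial]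

/-! ### Transfer to the presented algebra -/

/-- The extension by zero to `ℕ` of a function on `Fin m`. -/
def extendZero {α : Type*} [Zero α] {m : ℕ} (f : Fin m → α) (i : ℕ) : α :=
  if h : i < m then f ⟨i, h⟩ else 0

theorem extendZero_of_lt {α : Type*} [Zero α] {m : ℕ} (f : Fin m → α) {i : ℕ} (h : i < m) :
    extendZero f i = f ⟨i, h⟩ := dif_pos h

theorem word_map_prod {A : Type*} [Ring A] {N : ℕ} (f : Fin (N - 1) → A)
    (σ : Equiv.Perm (Fin N)) :
    ((word σ).map f).prod = codeProd (extendZero f) (permCode σ) := by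
  rw [word, List.map_flatten, List.prod_flatten, List.map_ofFn, List.map_ofFn, codeProd]
  congr 2
  funext i
  have hc := code_le σ i
  simp only [Function.comp_apply, run, List.map_ofFn, dsc]
  congr 1
  refine List.ext_getElem (by simp [permCode]; omega) fun t h1 h2 => ?_
  have ht : t < code σ i := by simpa using h1
  simp only [List.getElem_ofFn, List.getElem_map, List.getElem_range, Function.comp_apply]
  rw [extendZero_of_lt]

section extend

variable {K A : Type*} [Field K] [Ring A] [Algebra K A] {N : ℕ}
  {X : Fin (N - 1) → K} {Y : Fin (N - 2) → K} {f : Fin (N - 1) → A}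

theorem isOkada_extendZero (hsq : ∀ i, f i * f i = X i • f i)
    (hcomm : ∀ i j : Fin (N - 1), (i : ℕ) + 2 ≤ j → f i * f j = f j * f i)
    (hsand : ∀ i : Fin (N - 2), f ⟨i + 1, by omega⟩ * f ⟨i, by omega⟩ * f ⟨i + 1, by omega⟩ =
      Y i • f ⟨i + 1, by omega⟩) :
    IsOkada N (extendZero X) (extendZero Y) (extendZero f) where
  sq i hi := by
    rw [extendZero_of_lt f (by omega), extendZero_of_lt X (by omega)]
    exact hsq _
  comm i j hij hj := by
    rw [extendZero_of_lt f (by omega), extendZero_of_lt f (by omega)]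
    exact hcomm _ _ hij
  sandwich i hi := by
    rw [extendZero_of_lt f (i := i) (by omega), extendZero_of_lt f (i := i + 1) (by omega),
      extendZero_of_lt Y (by omega)]
    exact hsand ⟨i, by omega⟩

/-- Generators that satisfy the relations of the Okada algebra span through the monomials
attached to permutations. -/
theorem span_word_map_prod (h : IsOkada N (extendZero X) (extendZero Y) (extendZero f))
    (hf : Algebra.adjoin K (Set.range f) = ⊤) :
    Submodule.span K (Set.range fun σ : Equiv.Perm (Fin N) => ((word σ).map f).prod) = ⊤ := by
  have himage : extendZero f '' {i | i + 1 < N} = Set.range f := by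
    ext a
    constructor
    · rintro ⟨i, hi, rfl⟩
      have hi : i + 1 < N := hi
      exact ⟨⟨i, by omega⟩, (extendZero_of_lt f (by omega)).symm⟩
    · rintro ⟨i, rfl⟩
      exact ⟨i, show (i : ℕ) + 1 < N by omega, extendZero_of_lt f i.2⟩
  rw [← h.codeSpan_eq_top (himage.symm ▸ hf), codeSpan]
  simp only [word_map_prod]
  rw [← permCode_bijective.surjective.range_comp]
  rfl

end extend

section algebra

variable {K : Type*} [Field K] {N : ℕ} (X : Fin (N - 1) → K) (Y : Fin (N - 2) → K)

theorem Alg.gen_sq (i : Fin (N - 1)) : gen X Y i * gen X Y i = X i • gen X Y i := by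
  simpa [gen] using RingQuot.mkAlgHom_rel K (AlgRel.sq (X := X) (Y := Y) i)

theorem Alg.gen_comm (i j : Fin (N - 1)) (h : (i : ℕ) + 2 ≤ j) :
    gen X Y i * gen X Y j = gen X Y j * gen X Y i := by
  simpa [gen] using RingQuot.mkAlgHom_rel K (AlgRel.comm (X := X) (Y := Y) i j (Or.inl h))

theorem Alg.gen_sandwich (i : Fin (N - 2)) :
    gen X Y ⟨i + 1, by omega⟩ * gen X Y ⟨i, by omega⟩ * gen X Y ⟨i + 1, by omega⟩ =
      Y i • gen X Y ⟨i + 1, by omega⟩ := by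
  simpa [gen] using RingQuot.mkAlgHom_rel K (AlgRel.sandwich (X := X) (Y := Y) i)

theorem Alg.adjoin_range_gen : Algebra.adjoin K (Set.range (gen X Y)) = ⊤ := by
  have h : gen X Y = RingQuot.mkAlgHom K (AlgRel N X Y) ∘ FreeAlgebra.ι K := rfl
  rw [h, Set.range_comp, ← AlgHom.map_adjoin, FreeAlgebra.adjoin_range_ι, Algebra.map_top,
    AlgHom.range_eq_top]
  exact RingQuot.mkAlgHom_surjective K _

theorem Alg.span_range_e : Submodule.span K (Set.range (e X Y)) = ⊤ :=
  span_word_map_prod (isOkada_extendZero (gen_sq X Y) (gen_comm X Y) (gen_sandwich X Y))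
    (adjoin_range_gen X Y)

theorem Alg.linearIndependent_e : LinearIndependent K (e X Y) := by
  obtain ⟨A, _, _, g, hg, hli⟩ :=
    exists_isOkada_linearIndependent (extendZero X) (extendZero Y) N
  let f : Fin (N - 1) → A := fun i => g i
  have hrel : ∀ ⦃a b⦄, AlgRel N X Y a b →
      FreeAlgebra.lift K f a = FreeAlgebra.lift K f b := by
    intro a b hab
    induction hab with
    | sq i =>
      have := hg.sq i (by omega)
      rw [extendZero_of_lt X i.2] at this
      simpa [f] using this
    | comm i j h =>
      rcases h with h | h
      · simpa [f] using hg.comm i j h (by omega)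
      · simpa [f] using (hg.comm j i h (by omega)).symm
    | sandwich i =>
      have := hg.sandwich i (by omega)
      rw [extendZero_of_lt Y i.2] at this
      simpa [f] using this
  let φ : Alg N X Y →ₐ[K] A := RingQuot.liftAlgHom K ⟨FreeAlgebra.lift K f, hrel⟩
  have hφ : ∀ i, φ (gen X Y i) = f i := by
    intro i
    simp [φ, gen]
  refine LinearIndependent.of_comp φ.toLinearMap ?_
  convert hli.comp _ permCode_bijective.injective using 1
  funext σ
  -- `g` may be nonzero beyond the generators, where `extendZero f` vanishes, but code monomials
  -- only involve letters below N - 1.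
  have hcodeProd : codeProd (extendZero f) (permCode σ) = codeProd g (permCode σ) := by
    unfold codeProd dsc
    congr 2
    funext i
    congr 1
    refine List.map_congr_left fun t ht => ?_
    have := List.mem_range.1 ht
    exact extendZero_of_lt f (by omega)
  simp only [Function.comp_apply]
  rw [← hcodeProd, ← word_map_prod, e, AlgHom.toLinearMap_apply, map_list_prod, List.map_map]
  congr 2
  funext i
  exact hφ i

end algebra

/-! ### The Okada monoid -/

section monoid

variable {N : ℕ}

theorem Mon.gen_sq (i : Fin (N - 1)) : gen i * gen i = gen i :=
  Quotient.sound (ConGen.Rel.of _ _ (MonRel.sq i))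

theorem Mon.gen_comm (i j : Fin (N - 1)) (h : (i : ℕ) + 2 ≤ j) :
    gen i * gen j = gen j * gen i :=
  Quotient.sound (ConGen.Rel.of _ _ (MonRel.comm i j (Or.inl h)))

theorem Mon.gen_sandwich (i : Fin (N - 2)) :
    gen (N := N) ⟨i + 1, by omega⟩ * gen ⟨i, by omega⟩ * gen ⟨i + 1, by omega⟩ =
      gen ⟨i + 1, by omega⟩ :=
  Quotient.sound (ConGen.Rel.of _ _ (MonRel.sandwich i))

theorem Mon.e_injective : Function.Injective (e (N := N)) := by
  let g : Fin (N - 1) → Alg (K := ℚ) N 1 1 := Alg.gen 1 1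
  have hrel : ∀ a b, MonRel N a b → FreeMonoid.lift g a = FreeMonoid.lift g b := by
    intro a b hab
    induction hab with
    | sq i => simpa [g] using Alg.gen_sq (K := ℚ) 1 1 i
    | comm i j h =>
      rcases h with h | h
      · simpa [g] using Alg.gen_comm (K := ℚ) 1 1 i j h
      · simpa [g] using (Alg.gen_comm (K := ℚ) 1 1 j i h).symm
    | sandwich i => simpa [g] using Alg.gen_sandwich (K := ℚ) (N := N) 1 1 i
  let φ : Mon N →* Alg (K := ℚ) N 1 1 := PresentedMonoid.lift g hrel
  have hφ : ∀ σ, φ (e σ) = Alg.e 1 1 σ := by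
    intro σ
    rw [e, map_list_prod, List.map_map]
    rfl
  intro σ τ h
  exact (Alg.linearIndependent_e (K := ℚ) (N := N) 1 1).injective
    (by rw [← hφ, ← hφ, h])

theorem Mon.adjoin_range_of_gen :
    Algebra.adjoin ℚ (Set.range fun i => MonoidAlgebra.of ℚ (Mon N) (gen i)) = ⊤ := by
  rw [eq_top_iff]
  intro a _
  induction a using MonoidAlgebra.induction_on with
  | of m =>
    have hm : m ∈ Submonoid.closure (Set.range (PresentedMonoid.of (MonRel N))) := by
      rw [PresentedMonoid.closure_range_of]; trivial
    induction hm using Submonoid.closure_induction with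
    | mem m hm =>
      obtain ⟨i, rfl⟩ := hm
      exact Algebra.subset_adjoin ⟨i, rfl⟩
    | one => rw [map_one]; exact one_mem _
    | mul a b _ _ ha hb => rw [map_mul]; exact mul_mem (ha trivial) (hb trivial)
  | add a b ha hb => exact add_mem (ha trivial) (hb trivial)
  | smul r a ha => exact Subalgebra.smul_mem _ (ha trivial) r

theorem Mon.e_surjective : Function.Surjective (e (N := N)) := by
  let f : Fin (N - 1) → MonoidAlgebra ℚ (Mon N) := fun i => MonoidAlgebra.of ℚ (Mon N) (gen i)
  have hf : IsOkada N (extendZero (1 : Fin (N - 1) → ℚ)) (extendZero (1 : Fin (N - 2) → ℚ))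
      (extendZero f) := by
    refine isOkada_extendZero (fun i => ?_) (fun i j h => ?_) fun i => ?_
    · rw [← map_mul, gen_sq, Pi.one_apply, one_smul]
    · rw [← map_mul, gen_comm i j h, map_mul]
    · rw [← map_mul, ← map_mul, gen_sandwich, Pi.one_apply, one_smul]
  have hspan := span_word_map_prod hf adjoin_range_of_gen
  have himage : (Set.range fun σ : Equiv.Perm (Fin N) => ((word σ).map f).prod) =
      MonoidAlgebra.of ℚ (Mon N) '' Set.range (e (N := N)) := by
    rw [← Set.range_comp]
    congr 1
    funext σ
    rw [Function.comp_apply, e, map_list_prod, List.map_map]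
    rfl
  rw [himage] at hspan
  intro m
  have hm : MonoidAlgebra.of ℚ (Mon N) m ∈
      Submodule.span ℚ (MonoidAlgebra.of ℚ (Mon N) '' Set.range (e (N := N))) :=
    hspan ▸ Submodule.mem_top
  -- Monoid elements form a basis of the monoid algebra, so one in the span of a set of others must
  -- belong to that set.
  exact (MonoidAlgebra.of_mem_span_of_iff.1 hm : m ∈ Set.range e)

end monoid

end Okada

theorem mainTheorem1 (N : ℕ) {K : Type*} [Field K]
    (X : Fin (N - 1) → K) (Y : Fin (N - 2) → K) :
    Function.Bijective (Okada.Mon.e : Equiv.Perm (Fin N) → Okada.Mon N) ∧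
    (∃ b : Module.Basis (Equiv.Perm (Fin N)) K (Okada.Alg N X Y),
      ∀ σ, b σ = Okada.Alg.e X Y σ) ∧
    Module.finrank K (Okada.Alg N X Y) = N.factorial := by
  let b : Module.Basis (Equiv.Perm (Fin N)) K (Okada.Alg N X Y) :=
    Module.Basis.mk (Okada.Alg.linearIndependent_e X Y) (Okada.Alg.span_range_e X Y).ge
  refine ⟨⟨Okada.Mon.e_injective, Okada.Mon.e_surjective⟩,
    ⟨b, fun σ => Module.Basis.mk_apply _ _ σ⟩, ?_⟩
  rw [Module.finrank_eq_card_basis b, Fintype.card_perm, Fintype.card_fin]
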